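/- Let $1\le k\le n$ and let $H$ be a map from a neighbourhood of $0\in\mathbb R$ to the Hermitian $n\times n$ complex matrices that is real analytic at $0$. Write $\lambda_1(t)\le\dots\le\lambda_n(t)$ for the eigenvalues of $H(t)$ in increasing order, with multiplicity, and assume $\lambda_1(0)=\dots=\lambda_k(0)$ and, if $k<n$, $\lambda_k(0)<\lambda_{k+1}(0)$. Let $$\overline\lambda(t)=\frac1k\sum_{j=1}^k\lambda_j(t),\qquad D_k(t)=\sqrt{\frac1k\sum_{j=1}^k\bigl(\lambda_j(t)-\overline\lambda(t)\bigr)^2}.$$ For a function $f$ analytic at $0$ let $\mathrm{ord}_0(f)\in\{0,1,2,\dots\}\cup\{\infty\}$ be its order of vanishing at $t=0$ (with $\mathrm{ord}_0(f)=\infty$ if $f$ vanishes identically near $0$); a minimum over an empty index set (which occurs only for $k=1$) is $\infty$. Then there is a permutation $i\mapsto i'$ of $\{1,\dots,n\}$ such that all the functions $$\widetilde\lambda_i(t)=\begin{cases}\lambda_i(t),& t\ge 0,\\ \lambda_{i'}(t),& t<0,\end{cases}\qquad 1\le i\le n,$$ are analytic at $0$. Moreover, there is an $r\in\{0,1,2,\dots\}\cup\{\infty\}$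 such that the signed standard deviation $$\mathfrak s_k(t)=(\mathrm{sgn}\,t)^r\,D_k(t)$$ (for $r=\infty$ the sign factor is omitted) is analytic at $0$ and such that, for every permutation as above, the functions $\mathfrak s_{i,j}=\widetilde\lambda_i-\widetilde\lambda_j$ and $\overline{\mathfrak s}_i=\widetilde\lambda_i-\overline\lambda$ ($1\le i,j\le k$) are analytic at $0$ and $$r=\mathrm{ord}_0(\mathfrak s_k)=\min_{1\le i<j\le k}\mathrm{ord}_0(\mathfrak s_{i,j})=\min_{1\le i\le k-1}\mathrm{ord}_0(\mathfrak s_{i,i+1})=\mathrm{ord}_0(\mathfrak s_{1,k})=\min_{1\le i\le k}\mathrm{ord}_0(\overline{\mathfrak s}_i).$$ -/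

import Mathlib

noncomputable section

namespace EnergySplitting

/-- Hermitian `n × n` complex matrices. -/
abbrev Herm (n : ℕ) : Type := {A : Matrix (Fin n) (Fin n) ℂ // A.IsHermitian}

/-- The eigenvalues `λ₁ ≤ ⋯ ≤ λₙ` of a Hermitian matrix, with multiplicity, in increasing order
(`eig A i` is `λ_{i+1}`). Mathlib's `eigenvalues₀` lists them in decreasing order. -/
def eig {n : ℕ} (A : Herm n) (i : Fin n) : ℝ :=
  A.2.eigenvalues₀ (Fin.cast (Fintype.card_fin n).symm i.rev)

theorem eig_monotone {n : ℕ} (A : Herm n) : Monotone (eig A) := by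
  intro i j hij
  refine A.2.eigenvalues₀_antitone ?_
  have h : (i : ℕ) ≤ j := hij
  simp only [Fin.le_def, Fin.val_cast, Fin.val_rev]
  omega

/-- `Σ_k`: the matrices with `λ₁ = ⋯ = λ_k < λ_{k+1}` (the last inequality is void for `k = n`). -/
def GroundDegenerate (n k : ℕ) : Set (Herm n) :=
  {A | (∀ i j : Fin n, (i : ℕ) < k → (j : ℕ) < k → eig A i = eig A j) ∧
    ∀ i j : Fin n, (i : ℕ) + 1 = k → (j : ℕ) = k → eig A i < eig A j}

/-- The mean of the lowest `k` eigenvalues. -/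
def lowMean {n k : ℕ} (hkn : k ≤ n) (A : Herm n) : ℝ :=
  (∑ i : Fin k, eig A (Fin.castLE hkn i)) / k

/-- The standard deviation `D_k` of the lowest `k` eigenvalues. -/
def lowStdDev {n k : ℕ} (hkn : k ≤ n) (A : Herm n) : ℝ :=
  Real.sqrt ((∑ i : Fin k, (eig A (Fin.castLE hkn i) - lowMean hkn A) ^ 2) / k)

section Family

attribute [local instance] Matrix.frobeniusNormedAddCommGroup Matrix.frobeniusNormedSpace

/-- `H` is real analytic at `0`, as a map into the matrices with the Frobenius norm. -/
def AnalyticAtZero {n : ℕ} (H : ℝ → Herm n) : Prop :=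
  AnalyticAt ℝ (fun t => (H t : Matrix (Fin n) (Fin n) ℂ)) 0

end Family

/-- The eigenvalue functions, re-indexed by the permutation `σ` for negative `t`. -/
def reorderedEig {n : ℕ} (H : ℝ → Herm n) (σ : Equiv.Perm (Fin n)) (i : Fin n) (t : ℝ) : ℝ :=
  if 0 ≤ t then eig (H t) i else eig (H t) (σ i)

/-- `σ` is a re-indexing for negative `t` that makes all eigenvalue functions analytic at `0`. -/
def IsAnalyticReordering {n : ℕ} (H : ℝ → Herm n) (σ : Equiv.Perm (Fin n)) : Prop :=
  ∀ i : Fin n, AnalyticAt ℝ (reorderedEig H σ i) 0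

/-- The pairwise splitting of the `i`-th and `j`-th eigenvalue, for `i, j` among the lowest `k`. -/
def pairSplitting {n k : ℕ} (hkn : k ≤ n) (H : ℝ → Herm n) (σ : Equiv.Perm (Fin n))
    (i j : Fin k) (t : ℝ) : ℝ :=
  reorderedEig H σ (Fin.castLE hkn i) t - reorderedEig H σ (Fin.castLE hkn j) t

/-- The splitting of the `i`-th eigenvalue from the mean of the lowest `k` eigenvalues. -/
def meanSplitting {n k : ℕ} (hkn : k ≤ n) (H : ℝ → Herm n) (σ : Equiv.Perm (Fin n))
    (i : Fin k) (t : ℝ) : ℝ :=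
  reorderedEig H σ (Fin.castLE hkn i) t - lowMean hkn (H t)

/-- The signed standard deviation `sgn(t) ^ m * D_k(H(t))`. -/
def signedStdDev {n k : ℕ} (hkn : k ≤ n) (H : ℝ → Herm n) (m : ℕ) (t : ℝ) : ℝ :=
  Real.sign t ^ m * lowStdDev hkn (H t)

end EnergySplitting

end

/-!
Centre the real roots of the characteristic polynomial of `H t` and let `2 m` be the order at `0`
of the sum of their squares. Divided by `t ^ m`, the roots belong to a polynomial whose coefficients
are still analytic and whose roots at `0` have mean zero but are not all zero. It therefore splits
at `0` into coprime factors, and multiplication of coprime factors is locally invertible, so that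
the splitting extends analytically; induction on the degree gives analytic eigenvalue branches.
Analytic branches are ordered on either side of `0`, and comparing the two orders gives the
permutation.

The gap confines every analytic reordering of the eigenvalues to the lowest `k` of them, so their
mean and `D_k ^ 2` are symmetric functions of analytic branches. Nothing cancels in a sum of
squares, hence `ord D_k ^ 2` is twice the minimal order of the splittings from the mean; and
`λ_k - λ_1` dominates all the splittings for `t > 0`, hence it has the least order among them.
-/

open Filter Asymptotics Polynomial
open scoped Topology ContDiff

namespace EnergySplitting

section Order

theorem analyticOrderAt_le_of_isBigO {𝕜 E F : Type*} [NontriviallyNormedField 𝕜]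
    [NormedAddCommGroup E] [NormedSpace 𝕜 E] [NormedAddCommGroup F] [NormedSpace 𝕜 F]
    {f : 𝕜 → E} {g : 𝕜 → F} {x₀ : 𝕜} {l : Filter 𝕜} [l.NeBot] (hl : l ≤ 𝓝[≠] x₀)
    (hf : AnalyticAt 𝕜 f x₀) (hg : AnalyticAt 𝕜 g x₀) (hfg : f =O[l] g) :
    analyticOrderAt g x₀ ≤ analyticOrderAt f x₀ := by
  by_contra! hlt
  obtain ⟨u, hu, hu0, hfu⟩ := hf.analyticOrderAt_ne_top.1 hlt.ne_top
  set m := analyticOrderNatAt f x₀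
  have hm : ((m + 1 : ℕ) : ℕ∞) ≤ analyticOrderAt g x₀ := by
    rw [Nat.cast_add_one, Nat.cast_analyticOrderNatAt hlt.ne_top]
    exact Order.add_one_le_of_lt hlt
  obtain ⟨v, hv, hgv⟩ := (natCast_le_analyticOrderAt hg).1 hm
  have hl' : l ≤ 𝓝 x₀ := hl.trans nhdsWithin_le_nhds
  have hO : u =O[l] fun z => (z - x₀) • v z := by
    obtain ⟨C, hC⟩ := hfg.bound
    refine .of_bound C ?_
    filter_upwards [hC, hfu.filter_mono hl', hgv.filter_mono hl', hl self_mem_nhdsWithin]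
      with z hz hfz hgz (hne : z ≠ x₀)
    rw [hfz, hgz, pow_succ, mul_smul, norm_smul, norm_smul _ ((z - x₀) • v z),
      mul_left_comm] at hz
    exact le_of_mul_le_mul_left hz (norm_pos_iff.2 (pow_ne_zero _ (sub_ne_zero.2 hne)))
  have hlim : Tendsto (fun z => (z - x₀) • v z) l (𝓝 0) := by
    have h : ContinuousAt (fun z => (z - x₀) • v z) x₀ :=
      (continuousAt_id.sub continuousAt_const).smul hv.continuousAt
    simpa using h.tendsto.mono_left hl'
  exact hu0 (tendsto_nhds_unique (hu.continuousAt.tendsto.mono_left hl') (hO.trans_tendsto hlim))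

theorem exists_eventuallyEq_pow_mul_of_isBigO {𝕜 : Type*} [NontriviallyNormedField 𝕜]
    {f : 𝕜 → 𝕜} {x₀ : 𝕜} {l : Filter 𝕜} [l.NeBot] (hl : l ≤ 𝓝[≠] x₀)
    (hf : AnalyticAt 𝕜 f x₀) {n : ℕ} (h : f =O[l] fun z => (z - x₀) ^ n) :
    ∃ g : 𝕜 → 𝕜, AnalyticAt 𝕜 g x₀ ∧ ∀ᶠ z in 𝓝 x₀, f z = (z - x₀) ^ n * g z := by
  have hle := analyticOrderAt_le_of_isBigO hl hf (g := fun z => (z - x₀) ^ n) (by fun_prop) h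
  have hn : analyticOrderAt (fun z => (z - x₀) ^ n) x₀ = n := analyticOrderAt_centeredMonomial
  simpa only [smul_eq_mul] using (natCast_le_analyticOrderAt hf).1 (hn ▸ hle)

theorem le_analyticOrderAt_sum {𝕜 E ι : Type*} [NontriviallyNormedField 𝕜]
    [NormedAddCommGroup E] [NormedSpace 𝕜 E] {f : ι → 𝕜 → E} {x₀ : 𝕜} {N : ℕ∞} (s : Finset ι)
    (h : ∀ i ∈ s, N ≤ analyticOrderAt (f i) x₀) :
    N ≤ analyticOrderAt (∑ i ∈ s, f i) x₀ :=
  Finset.sum_induction f (fun g => N ≤ analyticOrderAt g x₀)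
    (fun _ _ hf hg => (le_min hf hg).trans le_analyticOrderAt_add)
    (le_top.trans_eq (analyticOrderAt_eq_top.2 (Eventually.of_forall fun _ => rfl)).symm) h

section Real

variable {f g S : ℝ → ℝ} {x₀ : ℝ}

theorem eventually_le_or_eventually_lt_of_analyticAt (hf : AnalyticAt ℝ f x₀)
    (hg : AnalyticAt ℝ g x₀) :
    (∀ᶠ t in 𝓝[>] x₀, f t ≤ g t) ∨ ∀ᶠ t in 𝓝[>] x₀, g t < f t := by
  rcases eq_or_ne (analyticOrderAt (f - g) x₀) ⊤ with htop | hne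
  · refine .inl ((analyticOrderAt_eq_top.1 htop).filter_mono nhdsWithin_le_nhds |>.mono ?_)
    exact fun t ht => (sub_eq_zero.1 ht).le
  obtain ⟨u, hu, hu0, hfgu⟩ := (hf.sub hg).analyticOrderAt_ne_top.1 hne
  replace hfgu : ∀ᶠ t in 𝓝[>] x₀, f t - g t = (t - x₀) ^ _ * u t := nhdsWithin_le_nhds hfgu
  rcases hu0.lt_or_gt with hneg | hpos
  · left
    filter_upwards [hfgu, self_mem_nhdsWithin,
      nhdsWithin_le_nhds (hu.continuousAt.eventually_lt_const hneg)] with t ht htx hut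
    exact sub_nonpos.1 (ht ▸ mul_nonpos_of_nonneg_of_nonpos
      (pow_nonneg (sub_nonneg.2 (Set.mem_Ioi.1 htx).le) _) hut.le)
  · right
    filter_upwards [hfgu, self_mem_nhdsWithin,
      nhdsWithin_le_nhds (hu.continuousAt.eventually_const_lt hpos)] with t ht htx hut
    exact sub_pos.1 (ht ▸ mul_pos (pow_pos (sub_pos.2 htx) _) hut)

theorem exists_eventuallyEq_sq_mul_pos (hS : AnalyticAt ℝ S x₀)
    (hnonneg : ∀ᶠ t in 𝓝 x₀, 0 ≤ S t) (hne : analyticOrderAt S x₀ ≠ ⊤) :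
    ∃ (m : ℕ) (u : ℝ → ℝ), AnalyticAt ℝ u x₀ ∧ 0 < u x₀ ∧ analyticOrderAt S x₀ = 2 * m ∧
      ∀ᶠ t in 𝓝 x₀, S t = ((t - x₀) ^ m) ^ 2 * u t := by
  obtain ⟨u, hu, hu0, hSu⟩ := hS.analyticOrderAt_ne_top.1 hne
  have he := Nat.cast_analyticOrderNatAt hne
  set e := analyticOrderNatAt S x₀
  replace hSu : ∀ᶠ t in 𝓝 x₀, S t = (t - x₀) ^ e * u t := hSu
  have hpos : 0 < u x₀ := by
    refine (ge_of_tendsto (hu.continuousAt.tendsto.mono_left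
      (nhdsWithin_le_nhds (s := Set.Ioi x₀))) ?_).lt_of_ne' hu0
    filter_upwards [self_mem_nhdsWithin, nhdsWithin_le_nhds hSu, nhdsWithin_le_nhds hnonneg]
      with t ht h1 h2
    exact nonneg_of_mul_nonneg_right (h1 ▸ h2) (pow_pos (sub_pos.2 ht) e)
  have heven : Even e := by
    by_contra hodd
    suffices ∀ᶠ _ in 𝓝[<] x₀, False from this.exists.elim fun _ => id
    filter_upwards [self_mem_nhdsWithin, nhdsWithin_le_nhds hSu, nhdsWithin_le_nhds hnonneg,
      nhdsWithin_le_nhds (hu.continuousAt.eventually_const_lt hpos)] with t ht h1 h2 hut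
    exact (h1 ▸ h2).not_gt (mul_neg_of_neg_of_pos
      ((Nat.not_even_iff_odd.1 hodd).pow_neg (sub_neg.2 ht)) hut)
  obtain ⟨m, hm⟩ := heven
  refine ⟨m, u, hu, hpos, by rw [← he, hm, Nat.cast_add, two_mul], ?_⟩
  simpa only [hm, ← pow_mul, mul_two] using hSu

theorem analyticOrderAt_sum_sq {ι : Type*} [Fintype ι] {f : ι → ℝ → ℝ}
    (hf : ∀ i, AnalyticAt ℝ (f i) x₀) :
    analyticOrderAt (fun t => ∑ i, f i t ^ 2) x₀ = 2 * ⨅ i, analyticOrderAt (f i) x₀ := by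
  have hsum : (fun t => ∑ i, f i t ^ 2) = ∑ i, f i ^ 2 := by
    ext t
    simp only [Finset.sum_apply, Pi.pow_apply]
  have hsq : ∀ i, analyticOrderAt (f i ^ 2) x₀ = 2 * analyticOrderAt (f i) x₀ := fun i => by
    rw [analyticOrderAt_pow (hf i), nsmul_eq_mul, Nat.cast_ofNat]
  refine le_antisymm ?_ (hsum ▸ le_analyticOrderAt_sum _ fun i _ => ?_)
  · rcases isEmpty_or_nonempty ι with hι | hι
    · simp [iInf_of_empty]
    obtain ⟨i, hi⟩ := exists_eq_ciInf_of_finite (f := fun i => analyticOrderAt (f i) x₀)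
    rw [← hi, ← hsq]
    refine analyticOrderAt_le_of_isBigO (l := 𝓝[≠] x₀) le_rfl ((hf i).pow 2)
      (by fun_prop) (.of_norm_le fun t => ?_)
    rw [Pi.pow_apply, Real.norm_of_nonneg (sq_nonneg _)]
    exact Finset.single_le_sum (fun j _ => sq_nonneg (f j t)) (Finset.mem_univ i)
  · rw [hsq]
    gcongr
    exact iInf_le _ i

theorem sign_mul_abs_self (t : ℝ) : Real.sign t * |t| = t := by
  rcases lt_trichotomy t 0 with h | rfl | h
  · rw [Real.sign_of_neg h, abs_of_neg h, neg_one_mul, neg_neg]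
  · rw [abs_zero, mul_zero]
  · rw [Real.sign_of_pos h, abs_of_pos h, one_mul]

theorem analyticAt_sign_pow_mul_sqrt (hS : AnalyticAt ℝ S x₀) (hnonneg : ∀ᶠ t in 𝓝 x₀, 0 ≤ S t)
    {r : ℕ∞} (hr : analyticOrderAt S x₀ = 2 * r) :
    AnalyticAt ℝ (fun t => Real.sign (t - x₀) ^ r.toNat * √(S t)) x₀ ∧
      analyticOrderAt (fun t => Real.sign (t - x₀) ^ r.toNat * √(S t)) x₀ = r := by
  have hinj : Function.Injective fun a : ℕ∞ => 2 * a :=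
    (ENat.mul_right_strictMono two_ne_zero (ENat.natCast_ne_top 2)).injective
  rcases eq_or_ne (analyticOrderAt S x₀) ⊤ with htop | hne
  · have hzero : ∀ᶠ t in 𝓝 x₀, Real.sign (t - x₀) ^ r.toNat * √(S t) = 0 :=
      (analyticOrderAt_eq_top.1 htop).mono fun t ht => by rw [ht, Real.sqrt_zero, mul_zero]
    have hr_top : r = ⊤ := hinj (hr.symm.trans (htop.trans (ENat.mul_top two_ne_zero).symm))
    exact ⟨analyticAt_const.congr (EventuallyEq.symm hzero),
      (analyticOrderAt_eq_top.2 hzero).trans hr_top.symm⟩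
  obtain ⟨m, u, hu, hu0, hord, hSu⟩ := exists_eventuallyEq_sq_mul_pos hS hnonneg hne
  obtain rfl : r = m := hinj (hr.symm.trans hord)
  rw [ENat.toNat_natCast]
  have heq : (fun t => Real.sign (t - x₀) ^ m * √(S t)) =ᶠ[𝓝 x₀]
      fun t => (t - x₀) ^ m • √(u t) := by
    filter_upwards [hSu] with t ht
    rw [ht, Real.sqrt_mul (sq_nonneg _), Real.sqrt_sq_eq_abs, abs_pow, ← mul_assoc, ← mul_pow,
      sign_mul_abs_self, smul_eq_mul]
  have hsqrt : AnalyticAt ℝ (fun t => √(u t)) x₀ :=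
    (Real.contDiffAt_sqrt hu0.ne').analyticAt.fun_comp hu
  have han : AnalyticAt ℝ (fun t => Real.sign (t - x₀) ^ m * √(S t)) x₀ :=
    AnalyticAt.congr (by fun_prop) heq.symm
  exact ⟨han, han.analyticOrderAt_eq_natCast.2
    ⟨_, hsqrt, (Real.sqrt_pos.2 hu0).ne', heq⟩⟩

end Real

end Order

section Coprime

theorem ofFn_toFn_of_degree_lt {R : Type*} [Semiring R] [DecidableEq R] {n : ℕ} {f : R[X]}
    (hf : f.degree < n) : ofFn n (toFn n f) = f := by
  ext i
  rcases lt_or_ge i n with hi | hi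
  · rw [ofFn_coeff_eq_val_of_lt _ hi]
    rfl
  · rw [ofFn_coeff_eq_zero_of_ge _ hi, (degree_lt_iff_coeff_zero _ _).1 hf i hi]

theorem degree_sub_lt_of_monic {R : Type*} [Ring R] [Nontrivial R] {p q : R[X]} {n : ℕ}
    (hp : p.Monic) (hq : q.Monic) (hpn : p.natDegree = n) (hqn : q.natDegree = n) :
    (p - q).degree < n := by
  have hpd : p.degree = n := (degree_eq_natDegree hp.ne_zero).trans (congrArg _ hpn)
  have hqd : q.degree = n := (degree_eq_natDegree hq.ne_zero).trans (congrArg _ hqn)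
  exact hpd ▸ degree_sub_lt_left (hpd.trans hqd.symm) hp.ne_zero (hp.trans hq.symm)

variable {R : Type*} [CommRing R] {f g u z : R[X]}

/-- The differential `(u, z) ↦ u * g + f * z` of polynomial multiplication at `(f, g)`, in terms of
coefficient vectors: `u`, `z` and the value have degrees below those of `f`, `g` and `f * g`. -/
noncomputable def mulDifferential [DecidableEq R] (f g : R[X]) :
    (Fin f.natDegree → R) × (Fin g.natDegree → R) →ₗ[R] Fin (f.natDegree + g.natDegree) → R :=
  toFn _ ∘ₗ (LinearMap.mulRight R g ∘ₗ ofFn _).coprod (LinearMap.mulLeft R f ∘ₗ ofFn _)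

theorem mulDifferential_apply [DecidableEq R] (f g : R[X])
    (x : (Fin f.natDegree → R) × (Fin g.natDegree → R)) :
    mulDifferential f g x = toFn _ (ofFn _ x.1 * g + f * ofFn _ x.2) :=
  rfl

variable [IsDomain R]

theorem eq_zero_of_mul_add_mul_eq_zero (hfg : IsCoprime f g) (hf : f ≠ 0)
    (hu : u.degree < f.degree) (h : u * g + f * z = 0) : u = 0 ∧ z = 0 := by
  have hu0 : u = 0 :=
    eq_zero_of_dvd_of_degree_lt (hfg.dvd_of_dvd_mul_right ⟨-z, by linear_combination h⟩) hu
  rw [hu0, zero_mul, zero_add] at h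
  exact ⟨hu0, (mul_eq_zero.1 h).resolve_left hf⟩

theorem degree_mul_add_mul_lt (hf : f ≠ 0) (hg : g ≠ 0) (hu : u.degree < f.degree)
    (hz : z.degree < g.degree) :
    (u * g + f * z).degree < (f.natDegree + g.natDegree : ℕ) := by
  rw [Nat.cast_add, ← degree_eq_natDegree hf, ← degree_eq_natDegree hg]
  refine (degree_add_le _ _).trans_lt (max_lt ?_ ?_)
  · rw [degree_mul]
    exact WithBot.add_lt_add_right (degree_ne_bot.2 hg) hu
  · rw [degree_mul]
    exact WithBot.add_lt_add_left (degree_ne_bot.2 hf) hz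

theorem injective_mulDifferential [DecidableEq R] (hf : f ≠ 0) (hg : g ≠ 0) (hfg : IsCoprime f g) :
    Function.Injective (mulDifferential f g) := by
  rw [injective_iff_map_eq_zero]
  rintro ⟨u, z⟩ h
  have hu : (ofFn _ u).degree < f.degree :=
    (ofFn_degree_lt u).trans_eq (degree_eq_natDegree hf).symm
  have hz : (ofFn _ z).degree < g.degree :=
    (ofFn_degree_lt z).trans_eq (degree_eq_natDegree hg).symm
  rw [mulDifferential_apply] at h
  have h0 : ofFn _ u * g + f * ofFn _ z = 0 := by
    rw [← ofFn_toFn_of_degree_lt (degree_mul_add_mul_lt hf hg hu hz), h, ofFn_zero]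
  obtain ⟨hu0, hz0⟩ := eq_zero_of_mul_add_mul_eq_zero hfg hf hu h0
  exact Prod.ext (injective_ofFn _ (hu0.trans (ofFn_zero _).symm))
    (injective_ofFn _ (hz0.trans (ofFn_zero _).symm))

end Coprime

section Hensel

variable {𝕜 E : Type*} [RCLike 𝕜] [NormedAddCommGroup E] [NormedSpace 𝕜 E]

theorem exists_analyticAt_eventually_comp_eq {F G : Type*} [NormedAddCommGroup F] [NormedSpace 𝕜 F]
    [CompleteSpace F] [NormedAddCommGroup G] [NormedSpace 𝕜 G] {Φ : F → G} {a : F}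
    {e : F ≃L[𝕜] G} (hΦ : ContDiffAt 𝕜 ω Φ a) (hder : HasFDerivAt Φ (e : F →L[𝕜] G) a)
    {y : E → G} {x₀ : E} (hy : AnalyticAt 𝕜 y x₀) (hy₀ : y x₀ = Φ a) :
    ∃ w : E → F, AnalyticAt 𝕜 w x₀ ∧ w x₀ = a ∧ ∀ᶠ t in 𝓝 x₀, Φ (w t) = y t := by
  have hω : (ω : WithTop ℕ∞) ≠ 0 := by simp
  have hinv : AnalyticAt 𝕜 (hΦ.localInverse hder hω) (y x₀) :=
    hy₀ ▸ (hΦ.to_localInverse hder hω).analyticAt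
  refine ⟨hΦ.localInverse hder hω ∘ y, hinv.comp hy, ?_, ?_⟩
  · rw [Function.comp_apply, hy₀, hΦ.localInverse_apply_image]
  · have hright := (hΦ.hasStrictFDerivAt' hder hω).eventually_right_inverse
    exact hy.continuousAt.eventually (hy₀ ▸ hright)

/-- A family of monic polynomials of constant degree `n` whose coefficients are analytic functions
of the parameter at `x₀`. -/
structure IsAnalyticMonicFamily (p : E → 𝕜[X]) (n : ℕ) (x₀ : E) : Prop where
  monic : ∀ t, (p t).Monic
  natDegree_eq : ∀ t, (p t).natDegree = n
  analyticAt_coeff : ∀ i, AnalyticAt 𝕜 (fun t => (p t).coeff i) x₀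

theorem isAnalyticMonicFamily_add_ofFn {f : 𝕜[X]} (hf : f.Monic) {a : ℕ} {v : E → Fin a → 𝕜}
    (hfa : f.natDegree = a) {x₀ : E} (hv : AnalyticAt 𝕜 v x₀) :
    IsAnalyticMonicFamily (fun t => f + ofFn a (v t)) a x₀ := by
  subst hfa
  have hdeg : ∀ t, (ofFn f.natDegree (v t)).degree < f.degree := fun t =>
    (ofFn_degree_lt (v t)).trans_eq (degree_eq_natDegree hf.ne_zero).symm
  refine ⟨fun t => hf.add_of_left (hdeg t),
    fun t => natDegree_eq_of_degree_eq (degree_add_eq_left_of_degree_lt (hdeg t)), fun i => ?_⟩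
  let coeffₗ : (Fin f.natDegree → 𝕜) →ₗ[𝕜] 𝕜 := lcoeff 𝕜 i ∘ₗ ofFn f.natDegree
  simp only [coeff_add]
  exact analyticAt_const.add
    ((LinearMap.toContinuousLinearMap coeffₗ).analyticAt _ |>.comp hv)

/-- The difference `(f + u) * (g + z) - f * g`, in terms of coefficient vectors of `u` and `z`. -/
noncomputable def mulIncrement (f g : 𝕜[X])
    (x : (Fin f.natDegree → 𝕜) × (Fin g.natDegree → 𝕜)) : Fin (f.natDegree + g.natDegree) → 𝕜 :=
  toFn _ ((f + ofFn _ x.1) * (g + ofFn _ x.2) - f * g)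

theorem contDiff_and_hasFDerivAt_mulIncrement (f g : 𝕜[X]) : ContDiff 𝕜 ω (mulIncrement f g) ∧
    HasFDerivAt (mulIncrement f g) (LinearMap.toContinuousLinearMap (mulDifferential f g)) 0 := by
  let μ : (Fin f.natDegree → 𝕜) →ₗ[𝕜] (Fin g.natDegree → 𝕜) →ₗ[𝕜]
      (Fin (f.natDegree + g.natDegree) → 𝕜) :=
    ((LinearMap.mul 𝕜 𝕜[X]).compl₁₂ (ofFn _) (ofFn _)).compr₂ (toFn _)
  have hμ : IsBoundedBilinearMap 𝕜 fun x : (Fin f.natDegree → 𝕜) × (Fin g.natDegree → 𝕜) =>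
      μ x.1 x.2 := (LinearMap.toContinuousBilinearMap μ).isBoundedBilinearMap
  have hsum : mulIncrement f g = fun x =>
      LinearMap.toContinuousLinearMap (mulDifferential f g) x + μ x.1 x.2 := by
    ext1 x
    have hμx : μ x.1 x.2 = toFn _ (ofFn _ x.1 * ofFn _ x.2) := rfl
    rw [LinearMap.coe_toContinuousLinearMap', mulDifferential_apply, hμx, ← map_add, mulIncrement]
    congr 1
    ring
  rw [hsum]
  refine ⟨(ContinuousLinearMap.contDiff _).add hμ.contDiff, ?_⟩
  refine ((ContinuousLinearMap.hasFDerivAt _).add (hμ.hasFDerivAt 0)).congr_fderiv ?_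
  ext x <;> simp

theorem IsAnalyticMonicFamily.exists_hensel_factorization {p : E → 𝕜[X]} {n : ℕ} {x₀ : E}
    (hp : IsAnalyticMonicFamily p n x₀) {f g : 𝕜[X]} (hf : f.Monic) (hg : g.Monic)
    (hfg : IsCoprime f g) (h₀ : p x₀ = f * g) :
    ∃ F G : E → 𝕜[X], IsAnalyticMonicFamily F f.natDegree x₀ ∧
      IsAnalyticMonicFamily G g.natDegree x₀ ∧ F x₀ = f ∧ G x₀ = g ∧
      ∀ᶠ t in 𝓝 x₀, p t = F t * G t := by
  have hn : (f * g).natDegree = n := h₀ ▸ hp.natDegree_eq x₀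
  rw [hf.natDegree_mul hg] at hn
  have ofFn_toFn_sub : ∀ {q : 𝕜[X]}, q.Monic → q.natDegree = n →
      ofFn _ (toFn (f.natDegree + g.natDegree) (q - f * g)) = q - f * g := fun hq hqn =>
    ofFn_toFn_of_degree_lt
      (hn ▸ degree_sub_lt_of_monic hq (hf.mul hg) hqn ((hf.natDegree_mul hg).trans hn))
  obtain ⟨hsmooth, hder⟩ := contDiff_and_hasFDerivAt_mulIncrement f g
  let e := (LinearEquiv.ofInjectiveOfFinrankEq (mulDifferential f g)
    (injective_mulDifferential hf.ne_zero hg.ne_zero hfg) (by simp)).toContinuousLinearEquiv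
  have hy : AnalyticAt 𝕜 (fun t => toFn (f.natDegree + g.natDegree) (p t - f * g)) x₀ :=
    analyticAt_pi_iff.2 fun i => by
      simpa only [toFn, LinearMap.pi_apply, lcoeff_apply, coeff_sub]
        using (hp.analyticAt_coeff i).fun_sub analyticAt_const
  obtain ⟨w, hw, hw₀, hwp⟩ := exists_analyticAt_eventually_comp_eq (e := e)
    hsmooth.contDiffAt hder hy (by simp [mulIncrement, h₀])
  have hF := isAnalyticMonicFamily_add_ofFn hf rfl (analyticAt_fst.fun_comp hw)
  have hG := isAnalyticMonicFamily_add_ofFn hg rfl (analyticAt_snd.fun_comp hw)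
  refine ⟨_, _, hF, hG, by simp [hw₀], by simp [hw₀], ?_⟩
  filter_upwards [hwp] with t ht
  have hprod := congrArg (ofFn _) ht
  rw [mulIncrement, ofFn_toFn_sub (hp.monic t) (hp.natDegree_eq t),
    ofFn_toFn_sub ((hF.monic t).mul (hG.monic t))
      (by rw [(hF.monic t).natDegree_mul (hG.monic t), hF.natDegree_eq, hG.natDegree_eq, hn])]
    at hprod
  exact (sub_left_injective hprod).symm

end Hensel

section Roots

theorem sum_map_sq_eq_sub_esymm {R : Type*} [CommRing R] (s : Multiset R) :
    (s.map (· ^ 2)).sum = s.sum ^ 2 - 2 * s.esymm 2 := by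
  induction s using Multiset.induction_on with
  | empty => simp [Multiset.esymm, Multiset.powersetCard_zero_right]
  | cons a s ih =>
    have h : (a ::ₘ s).esymm 2 = s.esymm 2 + a * s.sum := by
      simpa [Multiset.esymm, Multiset.powersetCard_cons, Multiset.powersetCard_one] using
        Multiset.sum_map_mul_left (s := s) (a := a) (f := id)
    rw [Multiset.map_cons, Multiset.sum_cons, Multiset.sum_cons, ih, h]
    ring

theorem roots_scaleRoots_of_splits {K : Type*} [Field K] {p : K[X]} (hp : p.Splits) (s : K) :
    (p.scaleRoots s).roots = p.roots.map (s * ·) := by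
  have hprod : ∀ r : Multiset K, (r.map (X - C ·)).prod.scaleRoots s =
      ((r.map (s * ·)).map (X - C ·)).prod := fun r => by
    induction r using Multiset.induction_on with
    | empty => simp only [Multiset.map_zero, Multiset.prod_zero, one_scaleRoots]
    | cons a r ih =>
      rw [Multiset.map_cons, Multiset.prod_cons, mul_scaleRoots_of_noZeroDivisors, ih,
        X_sub_C_scaleRoots, mul_comm a, Multiset.map_cons, Multiset.map_cons, Multiset.prod_cons]
  rcases eq_or_ne p 0 with rfl | hp0
  · simp
  · conv_lhs => rw [hp.eq_prod_roots, mul_scaleRoots_of_noZeroDivisors, scaleRoots_C, hprod]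
    rw [roots_C_mul _ (leadingCoeff_ne_zero.2 hp0), roots_multiset_prod_X_sub_C]

theorem roots_eq_map_roots_taylor {R : Type*} [CommRing R] [IsDomain R] (p : R[X]) (c : R) :
    p.roots = (taylor c p).roots.map (· + c) := by
  simpa only [taylor_apply, map_one, one_mul] using
    (map_roots_comp_C_mul_X_add_C p 1 c isUnit_one).symm

theorem exists_coprime_factorization_of_roots {K : Type*} [Field K] {p : K[X]} (hp : p.Monic)
    {x y : K} (hx : x ∈ p.roots) (hy : y ∈ p.roots) (hxy : x ≠ y) :
    ∃ f g : K[X], f.Monic ∧ g.Monic ∧ IsCoprime f g ∧ p = f * g ∧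
      f.natDegree < p.natDegree ∧ g.natDegree < p.natDegree := by
  obtain ⟨g, hpg, hgx⟩ := exists_eq_pow_rootMultiplicity_mul_and_not_dvd p hp.ne_zero x
  set k := p.rootMultiplicity x
  have hf : ((X - C x) ^ k).Monic := (monic_X_sub_C x).pow k
  have hg : g.Monic := hf.of_mul_monic_left (hpg ▸ hp)
  have hk : 0 < k := (rootMultiplicity_pos hp.ne_zero).2 ((mem_roots hp.ne_zero).1 hx)
  have hgy : g.IsRoot y := by
    have hroot : ((X - C x) ^ k * g).IsRoot y := hpg ▸ (mem_roots hp.ne_zero).1 hy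
    rw [root_mul] at hroot
    refine hroot.resolve_left fun h => hxy (Eq.symm ?_)
    simpa [hk.ne', sub_eq_zero] using h
  have hg_pos : 0 < g.natDegree :=
    natDegree_pos_iff_degree_pos.2 (degree_pos_of_root hg.ne_zero hgy)
  have hdeg : p.natDegree = k + g.natDegree := by
    conv_lhs => rw [hpg, hf.natDegree_mul hg, natDegree_pow, natDegree_X_sub_C, mul_one]
  refine ⟨_, g, hf, hg, ((irreducible_X_sub_C x).coprime_iff_not_dvd.2 hgx).pow_left, hpg, ?_, ?_⟩
  · rw [natDegree_pow, natDegree_X_sub_C]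
    omega
  · omega

theorem exists_ne_of_sum_eq_zero_of_sum_sq_ne_zero {R : Type*} [Ring R] [CharZero R]
    [NoZeroDivisors R] {s : Multiset R} (h₁ : s.sum = 0) (h₂ : (s.map (· ^ 2)).sum ≠ 0) :
    ∃ x ∈ s, ∃ y ∈ s, x ≠ y := by
  obtain ⟨x, hx, hx0⟩ : ∃ x ∈ s, x ≠ 0 := by
    by_contra! h
    refine h₂ (Multiset.sum_eq_zero fun y hy => ?_)
    obtain ⟨z, hz, rfl⟩ := Multiset.mem_map.1 hy
    rw [h z hz, zero_pow two_ne_zero]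
  by_contra! h
  rw [Multiset.eq_replicate_card.2 fun y hy => (h x hx y hy).symm, Multiset.sum_replicate,
    smul_eq_zero] at h₁
  exact h₁.elim (Multiset.card_pos_iff_exists_mem.2 ⟨x, hx⟩).ne' hx0

theorem sum_map_sq_nonneg (s : Multiset ℝ) : 0 ≤ (s.map (· ^ 2)).sum :=
  Multiset.sum_nonneg fun y hy => by
    obtain ⟨z, -, rfl⟩ := Multiset.mem_map.1 hy
    exact sq_nonneg z

theorem sq_le_sum_map_sq {s : Multiset ℝ} {x : ℝ} (hx : x ∈ s) :
    x ^ 2 ≤ (s.map (· ^ 2)).sum := by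
  obtain ⟨s, rfl⟩ := Multiset.exists_cons_of_mem hx
  rw [Multiset.map_cons, Multiset.sum_cons]
  exact le_add_of_nonneg_right (sum_map_sq_nonneg s)

theorem abs_im_pow_natDegree_le_norm_aeval {p : ℝ[X]} (hp : p.Monic) (hs : p.Splits) (z : ℂ) :
    |z.im| ^ p.natDegree ≤ ‖aeval z p‖ := by
  have hprod : ∀ s : Multiset ℝ, |z.im| ^ s.card ≤ ‖aeval z (s.map (X - C ·)).prod‖ := fun s => by
    induction s using Multiset.induction_on with
    | empty => simp
    | cons a s ih =>
      rw [Multiset.map_cons, Multiset.prod_cons, map_mul, norm_mul, Multiset.card_cons, pow_succ']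
      refine mul_le_mul ?_ ih (by positivity) (norm_nonneg _)
      simpa using Complex.abs_im_le_norm (z - a)
  simpa only [← hs.eq_prod_roots_of_monic hp, splits_iff_card_roots.1 hs] using hprod p.roots

theorem splits_of_tendsto_coeff {α : Type*} {l : Filter α} [l.NeBot] {p : α → ℝ[X]} {q : ℝ[X]}
    (hp : ∀ t, (p t).Monic) (hdeg : ∀ t, (p t).natDegree = q.natDegree)
    (hlim : ∀ i, Tendsto (fun t => (p t).coeff i) l (𝓝 (q.coeff i)))
    (hs : ∀ᶠ t in l, (p t).Splits) : q.Splits := by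
  refine Splits.of_splits_map_of_injective (i := Complex.ofRealHom) Complex.ofRealHom.injective
    (IsAlgClosed.splits _) fun z hz => ?_
  have hz0 : aeval z q = 0 := by
    have hroot := (mem_roots'.1 hz).2
    rwa [IsRoot.def, eval_map] at hroot
  have haeval : Tendsto (fun t => ‖aeval z (p t)‖) l (𝓝 ‖aeval z q‖) := by
    simp only [aeval_eq_sum_range, hdeg]
    exact (tendsto_finsetSum _ fun i _ => (hlim i).smul_const _).norm
  have hle : |z.im| ^ q.natDegree ≤ 0 := by
    rw [hz0, norm_zero] at haeval
    refine ge_of_tendsto haeval (hs.mono fun t ht => ?_)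
    exact hdeg t ▸ abs_im_pow_natDegree_le_norm_aeval (hp t) ht z
  have him : z.im = 0 := by
    by_contra hne
    exact hle.not_gt (pow_pos (abs_pos.2 hne) _)
  exact ⟨z.re, Complex.ext rfl him.symm⟩

theorem sum_roots_taylor_mean {K : Type*} [Field K] [CharZero K] {p : K[X]} (hp : p.Splits) :
    (taylor (p.roots.sum / p.natDegree) p).roots.sum = 0 := by
  set c := p.roots.sum / p.natDegree
  have hsum : (p.roots.card : K) * c = p.roots.sum := by
    rw [splits_iff_card_roots.1 hp]
    refine mul_div_cancel_of_imp' fun hdeg => ?_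
    have hcard : p.roots.card = 0 := (splits_iff_card_roots.1 hp).trans (Nat.cast_eq_zero.1 hdeg)
    rw [Multiset.card_eq_zero.1 hcard, Multiset.sum_zero]
  rw [roots_eq_map_roots_taylor p c, Multiset.card_map, Multiset.sum_map_add, Multiset.map_id',
    Multiset.map_const', Multiset.sum_replicate, nsmul_eq_mul] at hsum
  exact left_eq_add.1 (hsum.trans (add_comm _ _))

end Roots

section AnalyticRoots

variable {𝕜 E : Type*} [RCLike 𝕜] [NormedAddCommGroup E] [NormedSpace 𝕜 E]

theorem IsAnalyticMonicFamily.taylor {p : E → 𝕜[X]} {n : ℕ} {x₀ : E} {c : E → 𝕜}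
    (hp : IsAnalyticMonicFamily p n x₀) (hc : AnalyticAt 𝕜 c x₀) :
    IsAnalyticMonicFamily (fun t => taylor (c t) (p t)) n x₀ := by
  refine ⟨fun t => (leadingCoeff_taylor _ _).trans (hp.monic t),
    fun t => (natDegree_taylor _ _).trans (hp.natDegree_eq t), fun i => ?_⟩
  have hdeg : ∀ t, (hasseDeriv i (p t)).natDegree < n + 1 := fun t =>
    ((natDegree_hasseDeriv_le _ _).trans (Nat.sub_le _ _)).trans_lt
      (hp.natDegree_eq t ▸ Nat.lt_succ_self _)
  simp only [taylor_coeff, eval_eq_sum_range' (hdeg _), hasseDeriv_coeff]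
  exact Finset.analyticAt_fun_sum _ fun j _ =>
    (analyticAt_const.mul (hp.analyticAt_coeff _)).mul (hc.pow j)

theorem IsAnalyticMonicFamily.analyticAt_esymm_roots {p : E → 𝕜[X]} {n : ℕ} {x₀ : E}
    (hp : IsAnalyticMonicFamily p n x₀) (hs : ∀ᶠ t in 𝓝 x₀, (p t).Splits) (k : ℕ) :
    AnalyticAt 𝕜 (fun t => (p t).roots.esymm k) x₀ := by
  by_cases hk : k ≤ n
  · refine (((hp.analyticAt_coeff (n - k)).const_smul (c := (-1 : 𝕜) ^ k))).congr ?_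
    filter_upwards [hs] with t ht
    have hn := hp.natDegree_eq t
    have hcoeff := coeff_eq_esymm_roots_of_card (splits_iff_card_roots.1 ht)
      (hn.symm ▸ Nat.sub_le n k)
    rw [(hp.monic t).leadingCoeff, hn, Nat.sub_sub_self hk, one_mul] at hcoeff
    rw [Pi.smul_apply, hcoeff, smul_eq_mul, ← mul_assoc, ← mul_pow, neg_one_mul, neg_neg, one_pow,
      one_mul]
  · refine analyticAt_const (v := (0 : 𝕜)).congr ?_
    filter_upwards [hs] with t ht
    have hcard : (p t).roots.card < k := by
      rw [splits_iff_card_roots.1 ht, hp.natDegree_eq]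
      exact not_le.1 hk
    rw [Multiset.esymm, Multiset.powersetCard_eq_empty _ hcard, Multiset.map_zero,
      Multiset.sum_zero]

theorem IsAnalyticMonicFamily.analyticAt_sum_roots {p : E → 𝕜[X]} {n : ℕ} {x₀ : E}
    (hp : IsAnalyticMonicFamily p n x₀) (hs : ∀ᶠ t in 𝓝 x₀, (p t).Splits) :
    AnalyticAt 𝕜 (fun t => (p t).roots.sum) x₀ := by
  simpa [Multiset.esymm, Multiset.powersetCard_one] using hp.analyticAt_esymm_roots hs 1

theorem IsAnalyticMonicFamily.analyticAt_sum_sq_roots {p : E → 𝕜[X]} {n : ℕ} {x₀ : E}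
    (hp : IsAnalyticMonicFamily p n x₀) (hs : ∀ᶠ t in 𝓝 x₀, (p t).Splits) :
    AnalyticAt 𝕜 (fun t => ((p t).roots.map (· ^ 2)).sum) x₀ := by
  simp only [sum_map_sq_eq_sub_esymm]
  exact ((hp.analyticAt_sum_roots hs).pow 2).sub
    (analyticAt_const.mul (hp.analyticAt_esymm_roots hs 2))

theorem IsAnalyticMonicFamily.exists_eventually_eq_scaleRoots {p : 𝕜 → 𝕜[X]} {n : ℕ} {x₀ : 𝕜}
    (hp : IsAnalyticMonicFamily p n x₀) (hs : ∀ᶠ t in 𝓝 x₀, (p t).Splits) {m : ℕ} {B : ℝ}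
    (hB : ∀ᶠ t in 𝓝 x₀, ∀ x ∈ (p t).roots, ‖x‖ ≤ ‖(t - x₀) ^ m‖ * B) :
    ∃ r : 𝕜 → 𝕜[X], IsAnalyticMonicFamily r n x₀ ∧
      ∀ᶠ t in 𝓝 x₀, p t = (r t).scaleRoots ((t - x₀) ^ m) := by
  have hO : ∀ i, (fun t => (p t).coeff i) =O[𝓝[≠] x₀] fun t => (t - x₀) ^ (m * (n - i)) := by
    refine fun i => .of_bound (B ^ (n - i) * n.choose i) ?_
    filter_upwards [hs.filter_mono nhdsWithin_le_nhds, hB.filter_mono nhdsWithin_le_nhds]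
      with t hst hBt
    have h := coeff_le_of_roots_le (f := RingHom.id 𝕜) i (hp.monic t)
      (by rwa [Polynomial.map_id]) (by simpa only [Polynomial.map_id] using hBt)
    rw [Polynomial.map_id, hp.natDegree_eq, mul_pow, ← norm_pow, ← pow_mul] at h
    exact h.trans_eq (by ring)
  choose b hb hpb using fun i =>
    exists_eventuallyEq_pow_mul_of_isBigO le_rfl (hp.analyticAt_coeff i) (hO i)
  let r : 𝕜 → 𝕜[X] := fun t => X ^ n + ofFn n fun i => b i t
  have hr : IsAnalyticMonicFamily r n x₀ :=
    isAnalyticMonicFamily_add_ofFn (monic_X_pow n) (natDegree_X_pow n)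
      (analyticAt_pi_iff.2 fun i => hb i)
  refine ⟨r, hr, ?_⟩
  filter_upwards [eventually_all.2 fun i : Fin n => hpb i] with t ht
  ext i
  rw [coeff_scaleRoots, hr.natDegree_eq, ← pow_mul]
  rcases lt_trichotomy i n with hi | rfl | hi
  · rw [ht ⟨i, hi⟩, coeff_add, coeff_X_pow, if_neg hi.ne, zero_add, ofFn_coeff_eq_val_of_lt _ hi,
      mul_comm]
  · have hpi := (hp.monic t).coeff_natDegree
    have hri := (hr.monic t).coeff_natDegree
    rw [hp.natDegree_eq] at hpi
    rw [hr.natDegree_eq] at hri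
    rw [hpi, hri, Nat.sub_self, mul_zero, pow_zero, mul_one]
  · rw [coeff_eq_zero_of_natDegree_lt ((hp.natDegree_eq t).trans_lt hi),
      coeff_eq_zero_of_natDegree_lt ((hr.natDegree_eq t).trans_lt hi), zero_mul]

theorem IsAnalyticMonicFamily.eventually_splits_of_nhdsNE {p : ℝ → ℝ[X]} {n : ℕ} {x₀ : ℝ}
    (hp : IsAnalyticMonicFamily p n x₀) (hs : ∀ᶠ t in 𝓝[≠] x₀, (p t).Splits) :
    ∀ᶠ t in 𝓝 x₀, (p t).Splits := by
  have h₀ : (p x₀).Splits :=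
    splits_of_tendsto_coeff hp.monic (fun t => (hp.natDegree_eq t).trans (hp.natDegree_eq x₀).symm)
      (fun i => (hp.analyticAt_coeff i).continuousAt.tendsto.mono_left nhdsWithin_le_nhds) hs
  filter_upwards [eventually_nhdsWithin_iff.1 hs] with t ht
  rcases eq_or_ne t x₀ with rfl | hne
  exacts [h₀, ht hne]

theorem IsAnalyticMonicFamily.eventually_splits_of_eventually_eq_scaleRoots {p r : ℝ → ℝ[X]}
    {n : ℕ} {x₀ : ℝ} (hr : IsAnalyticMonicFamily r n x₀) (hp : ∀ᶠ t in 𝓝 x₀, (p t).Splits) {m : ℕ}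
    (hpr : ∀ᶠ t in 𝓝 x₀, p t = (r t).scaleRoots ((t - x₀) ^ m)) :
    ∀ᶠ t in 𝓝 x₀, (r t).Splits := by
  refine hr.eventually_splits_of_nhdsNE ?_
  filter_upwards [self_mem_nhdsWithin, hp.filter_mono nhdsWithin_le_nhds,
    hpr.filter_mono nhdsWithin_le_nhds] with t ht hpt hprt
  have hrp : r t = (p t).scaleRoots ((t - x₀) ^ m)⁻¹ := by
    rw [hprt, ← scaleRoots_mul, mul_inv_cancel₀ (pow_ne_zero _ (sub_ne_zero.2 ht)), scaleRoots_one]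
  exact hrp ▸ hpt.scaleRoots _

/-- Near `x₀` the roots of `p t`, with multiplicity, are the values at `t` of finitely many
functions that are analytic at `x₀`. -/
def HasAnalyticRoots (p : E → 𝕜[X]) (x₀ : E) : Prop :=
  ∃ s : Multiset (E → 𝕜), (∀ μ ∈ s, AnalyticAt 𝕜 μ x₀) ∧
    ∀ᶠ t in 𝓝 x₀, (p t).roots = s.map fun μ => μ t

theorem hasAnalyticRoots_of_taylor {p : E → 𝕜[X]} {x₀ : E} {c : E → 𝕜}
    (hc : AnalyticAt 𝕜 c x₀) (h : HasAnalyticRoots (fun t => taylor (c t) (p t)) x₀) :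
    HasAnalyticRoots p x₀ := by
  obtain ⟨s, hs, hps⟩ := h
  refine ⟨s.map (· + c), fun μ hμ => ?_, hps.mono fun t ht => ?_⟩
  · obtain ⟨ν, hν, rfl⟩ := Multiset.mem_map.1 hμ
    exact (hs ν hν).add hc
  · rw [roots_eq_map_roots_taylor (p t) (c t), ht, Multiset.map_map, Multiset.map_map]
    rfl

theorem HasAnalyticRoots.of_eventually_eq_scaleRoots {p r : E → 𝕜[X]} {x₀ : E} {a : E → 𝕜}
    (h : HasAnalyticRoots r x₀) (hs : ∀ᶠ t in 𝓝 x₀, (r t).Splits) (ha : AnalyticAt 𝕜 a x₀)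
    (hpr : ∀ᶠ t in 𝓝 x₀, p t = (r t).scaleRoots (a t)) : HasAnalyticRoots p x₀ := by
  obtain ⟨s, hs', hrs⟩ := h
  refine ⟨s.map (a * ·), fun μ hμ => ?_, ?_⟩
  · obtain ⟨ν, hν, rfl⟩ := Multiset.mem_map.1 hμ
    exact ha.mul (hs' ν hν)
  · filter_upwards [hrs, hs, hpr] with t hrst hst hprt
    rw [hprt, roots_scaleRoots_of_splits hst, hrst, Multiset.map_map, Multiset.map_map]
    rfl

theorem HasAnalyticRoots.of_eventually_eq_mul {p f g : E → 𝕜[X]} {x₀ : E}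
    (hf : HasAnalyticRoots f x₀) (hg : HasAnalyticRoots g x₀) (hp : ∀ᶠ t in 𝓝 x₀, p t ≠ 0)
    (hpfg : ∀ᶠ t in 𝓝 x₀, p t = f t * g t) : HasAnalyticRoots p x₀ := by
  obtain ⟨s, hs, hfs⟩ := hf
  obtain ⟨s', hs', hgs⟩ := hg
  refine ⟨s + s', fun μ hμ => (Multiset.mem_add.1 hμ).elim (hs μ) (hs' μ), ?_⟩
  filter_upwards [hfs, hgs, hp, hpfg] with t hft hgt hpt hpfgt
  rw [hpfgt] at hpt ⊢
  rw [roots_mul hpt, hft, hgt, Multiset.map_add]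

theorem IsAnalyticMonicFamily.exists_eventually_eq_scaleRoots_of_sum_eq_zero {p : ℝ → ℝ[X]}
    {n : ℕ} {x₀ : ℝ} (hp : IsAnalyticMonicFamily p n x₀) (hs : ∀ᶠ t in 𝓝 x₀, (p t).Splits)
    (hsum : ∀ᶠ t in 𝓝 x₀, (p t).roots.sum = 0)
    (hsq : analyticOrderAt (fun t => ((p t).roots.map (· ^ 2)).sum) x₀ ≠ ⊤) :
    ∃ (m : ℕ) (r : ℝ → ℝ[X]), IsAnalyticMonicFamily r n x₀ ∧ (∀ᶠ t in 𝓝 x₀, (r t).Splits) ∧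
      (∀ᶠ t in 𝓝 x₀, p t = (r t).scaleRoots ((t - x₀) ^ m)) ∧
      ∃ x ∈ (r x₀).roots, ∃ y ∈ (r x₀).roots, x ≠ y := by
  obtain ⟨m, u, hu, hu₀, -, hSu⟩ := exists_eventuallyEq_sq_mul_pos
    (hp.analyticAt_sum_sq_roots hs) (.of_forall fun t => sum_map_sq_nonneg (p t).roots) hsq
  have hbound : ∀ᶠ t in 𝓝 x₀, ∀ x ∈ (p t).roots, ‖x‖ ≤ ‖(t - x₀) ^ m‖ * √(u x₀ + 1) := by
    filter_upwards [hSu, hu.continuousAt.eventually_lt_const (lt_add_one _)] with t hSt hut x hx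
    rw [Real.norm_eq_abs, Real.norm_eq_abs, ← Real.sqrt_sq_eq_abs ((t - x₀) ^ m),
      ← Real.sqrt_mul (sq_nonneg _)]
    refine Real.abs_le_sqrt ((sq_le_sum_map_sq hx).trans (hSt.trans_le ?_))
    gcongr
  obtain ⟨r, hr, hpr⟩ := hp.exists_eventually_eq_scaleRoots hs hbound
  have hne : ∀ᶠ t in 𝓝[≠] x₀, (t - x₀) ^ m ≠ 0 := eventually_nhdsWithin_of_forall fun t ht =>
    pow_ne_zero _ (sub_ne_zero.2 ht)
  have hrs := hr.eventually_splits_of_eventually_eq_scaleRoots hs hpr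
  have hroots : ∀ᶠ t in 𝓝 x₀, (p t).roots = (r t).roots.map ((t - x₀) ^ m * ·) := by
    filter_upwards [hpr, hrs] with t hprt hrst
    rw [hprt, roots_scaleRoots_of_splits hrst]
  have hsum₀ : (r x₀).roots.sum = 0 := by
    refine (((hr.analyticAt_sum_roots hrs).continuousAt
      |>.eventuallyEq_nhds_iff_eventuallyEq_nhdsNE continuousAt_const).1 ?_).self_of_nhds
    filter_upwards [hne, hsum.filter_mono nhdsWithin_le_nhds, hroots.filter_mono nhdsWithin_le_nhds]
      with t hnet hsumt hrootst
    rw [hrootst, Multiset.sum_map_mul_left, Multiset.map_id'] at hsumt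
    exact (mul_eq_zero.1 hsumt).resolve_left hnet
  have hsq₀ : ((r x₀).roots.map (· ^ 2)).sum = u x₀ := by
    refine (((hr.analyticAt_sum_sq_roots hrs).continuousAt
      |>.eventuallyEq_nhds_iff_eventuallyEq_nhdsNE hu.continuousAt).1 ?_).self_of_nhds
    filter_upwards [hne, hSu.filter_mono nhdsWithin_le_nhds, hroots.filter_mono nhdsWithin_le_nhds]
      with t hnet hSt hrootst
    rw [hrootst, Multiset.map_map] at hSt
    simp only [Function.comp_def, mul_pow, Multiset.sum_map_mul_left] at hSt
    exact mul_left_cancel₀ (pow_ne_zero 2 hnet) (by simpa only [mul_pow] using hSt)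
  exact ⟨m, r, hr, hrs, hpr, exists_ne_of_sum_eq_zero_of_sum_sq_ne_zero hsum₀ (hsq₀ ▸ hu₀.ne')⟩

theorem IsAnalyticMonicFamily.hasAnalyticRoots_of_sum_sq_eq_zero {F : Type*}
    [NormedAddCommGroup F] [NormedSpace ℝ F] {p : F → ℝ[X]} {n : ℕ} {x₀ : F}
    (hp : IsAnalyticMonicFamily p n x₀) (hs : ∀ᶠ t in 𝓝 x₀, (p t).Splits)
    (hsq : ∀ᶠ t in 𝓝 x₀, ((p t).roots.map (· ^ 2)).sum = 0) : HasAnalyticRoots p x₀ := by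
  refine ⟨Multiset.replicate n 0, fun μ hμ => ?_, ?_⟩
  · rw [Multiset.eq_of_mem_replicate hμ]
    exact analyticAt_const
  · filter_upwards [hsq, hs] with t hsqt hst
    rw [Multiset.map_replicate, Multiset.eq_replicate, splits_iff_card_roots.1 hst,
      hp.natDegree_eq]
    exact ⟨rfl, fun x hx => sq_eq_zero_iff.1
      (((sq_le_sum_map_sq hx).trans_eq hsqt).antisymm (sq_nonneg x))⟩

theorem IsAnalyticMonicFamily.hasAnalyticRoots {p : ℝ → ℝ[X]} {n : ℕ} {x₀ : ℝ}
    (hp : IsAnalyticMonicFamily p n x₀) (hs : ∀ᶠ t in 𝓝 x₀, (p t).Splits) :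
    HasAnalyticRoots p x₀ := by
  induction n using Nat.strong_induction_on generalizing p with
  | h n ih =>
  let c : ℝ → ℝ := fun t => (p t).roots.sum / n
  have hc : AnalyticAt ℝ c x₀ := by
    simpa only [c, div_eq_mul_inv] using (hp.analyticAt_sum_roots hs).fun_mul analyticAt_const
  let q : ℝ → ℝ[X] := fun t => Polynomial.taylor (c t) (p t)
  have hq : IsAnalyticMonicFamily q n x₀ := hp.taylor hc
  have hqs : ∀ᶠ t in 𝓝 x₀, (q t).Splits := hs.mono fun t ht => ht.taylor _
  have hsum : ∀ᶠ t in 𝓝 x₀, (q t).roots.sum = 0 :=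
    hs.mono fun t ht => by
      simpa only [q, c, hp.natDegree_eq t] using sum_roots_taylor_mean ht
  suffices h : HasAnalyticRoots q x₀ from hasAnalyticRoots_of_taylor hc h
  by_cases hsq : analyticOrderAt (fun t => ((q t).roots.map (· ^ 2)).sum) x₀ = ⊤
  · exact hq.hasAnalyticRoots_of_sum_sq_eq_zero hqs (analyticOrderAt_eq_top.1 hsq)
  · obtain ⟨m, r, hr, hrs, hqr, x, hx, y, hy, hxy⟩ :=
      hq.exists_eventually_eq_scaleRoots_of_sum_eq_zero hqs hsum hsq
    obtain ⟨f, g, hf, hg, hfg, hrfg, hfn, hgn⟩ :=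
      exists_coprime_factorization_of_roots (hr.monic x₀) hx hy hxy
    rw [hr.natDegree_eq] at hfn hgn
    obtain ⟨F, G, hF, hG, -, -, hrFG⟩ := hr.exists_hensel_factorization hf hg hfg hrfg
    have hFGs : ∀ᶠ t in 𝓝 x₀, (F t).Splits ∧ (G t).Splits := by
      filter_upwards [hrFG, hrs] with t ht hrst
      exact (splits_mul (hF.monic t).ne_zero (hG.monic t).ne_zero).1 (ht ▸ hrst)
    have hrr : HasAnalyticRoots r x₀ :=
      (ih _ hfn hF (hFGs.mono fun _ h => h.1)).of_eventually_eq_mul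
        (ih _ hgn hG (hFGs.mono fun _ h => h.2)) (.of_forall fun t => (hr.monic t).ne_zero) hrFG
    exact hrr.of_eventually_eq_scaleRoots hrs (by fun_prop) hqr

end AnalyticRoots

section Sorting

variable {n : ℕ}

theorem eq_of_monotone_of_map_univ_eq {α : Type*} [LinearOrder α] {u v : Fin n → α}
    (hu : Monotone u) (hv : Monotone v) (h : Finset.univ.val.map u = Finset.univ.val.map v) :
    u = v := by
  rw [Fin.univ_val_map, Fin.univ_val_map, Multiset.coe_eq_coe] at h
  exact List.ofFn_injective (h.eq_of_sortedLE hu.sortedLE_ofFn hv.sortedLE_ofFn)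

theorem exists_perm_eventually_monotone {α β : Type*} [LinearOrder α] {μ : Fin n → β → α}
    {l : Filter β} [l.NeBot]
    (h : ∀ i j, (∀ᶠ t in l, μ i t ≤ μ j t) ∨ ∀ᶠ t in l, μ j t < μ i t) :
    ∃ τ : Equiv.Perm (Fin n), ∀ᶠ t in l, Monotone fun i => μ (τ i) t := by
  -- A sample point `s` at which all the eventual strict inequalities hold decides the order.
  obtain ⟨s, hs⟩ : ∃ s, ∀ i j, (∀ᶠ t in l, μ j t < μ i t) → μ j s < μ i s := by
    refine Eventually.exists (f := l) (eventually_all.2 fun i => eventually_all.2 fun j => ?_)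
    by_cases hij : ∀ᶠ t in l, μ j t < μ i t
    · exact hij.mono fun t ht _ => ht
    · exact .of_forall fun t ht => absurd ht hij
  refine ⟨Tuple.sort fun i => μ i s, eventually_all.2 fun i => eventually_all.2 fun j => ?_⟩
  by_cases hij : i ≤ j
  · have hle := Tuple.monotone_sort (fun i => μ i s) hij
    exact ((h _ _).resolve_right fun hlt => (hs _ _ hlt).not_ge hle).mono fun t ht _ => ht
  · exact .of_forall fun t ht => absurd ht hij

theorem exists_perm_eventually_monotone_nhdsGT {μ : Fin n → ℝ → ℝ} {x₀ : ℝ}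
    (hμ : ∀ i, AnalyticAt ℝ (μ i) x₀) :
    ∃ τ : Equiv.Perm (Fin n), ∀ᶠ t in 𝓝[>] x₀, Monotone fun i => μ (τ i) t :=
  exists_perm_eventually_monotone fun i j =>
    eventually_le_or_eventually_lt_of_analyticAt (hμ i) (hμ j)

theorem exists_perm_eventually_monotone_nhdsLT {μ : Fin n → ℝ → ℝ} {x₀ : ℝ}
    (hμ : ∀ i, AnalyticAt ℝ (μ i) x₀) :
    ∃ τ : Equiv.Perm (Fin n), ∀ᶠ t in 𝓝[<] x₀, Monotone fun i => μ (τ i) t := by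
  have hneg : ∀ i, AnalyticAt ℝ (fun t => μ i (-t)) (-x₀) := fun i =>
    AnalyticAt.fun_comp (g := μ i) (f := fun t : ℝ => -t) (by simpa only [neg_neg] using hμ i)
      analyticAt_id.fun_neg
  obtain ⟨τ, hτ⟩ := exists_perm_eventually_monotone_nhdsGT hneg
  exact ⟨τ, by simpa only [neg_neg] using tendsto_neg_nhdsLT.eventually hτ⟩

end Sorting

section Eigenvalues

theorem analyticAt_coeff_charpoly {𝕜 E A m : Type*} [NontriviallyNormedField 𝕜]
    [NormedAddCommGroup E] [NormedSpace 𝕜 E] [NormedCommRing A] [NormedAlgebra 𝕜 A] [Fintype m]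
    [DecidableEq m] {M : E → Matrix m m A} {x₀ : E}
    (hM : ∀ i j, AnalyticAt 𝕜 (fun t => M t i j) x₀) (k : ℕ) :
    AnalyticAt 𝕜 (fun t => (M t).charpoly.coeff k) x₀ := by
  refine (AnalyticAt.aeval_mvPolynomial (f := fun t (ij : m × m) => M t ij.1 ij.2)
    (fun ij => hM ij.1 ij.2) ((Matrix.charpoly.univ 𝕜 m).coeff k)).congr (.of_forall fun t => ?_)
  exact Matrix.charpoly.univ_coeff_eval₂Hom m (algebraMap 𝕜 A) (fun ij => M t ij.1 ij.2) k

attribute [local instance] Matrix.frobeniusNormedAddCommGroup Matrix.frobeniusNormedSpace in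
theorem AnalyticAtZero.apply {n : ℕ} {H : ℝ → Herm n} (hH : AnalyticAtZero H) (i j : Fin n) :
    AnalyticAt ℝ (fun t => (H t : Matrix (Fin n) (Fin n) ℂ) i j) 0 :=
  ((Matrix.entryLinearMap ℝ ℂ i j).toContinuousLinearMap.analyticAt _).comp hH

/-- The characteristic polynomial of a Hermitian matrix, as a real polynomial. -/
noncomputable def eigPoly {n : ℕ} (A : Herm n) : ℝ[X] := ∏ i : Fin n, (X - C (eig A i))

theorem map_ofReal_eigPoly {n : ℕ} (A : Herm n) :
    (eigPoly A).map Complex.ofRealHom = (A : Matrix (Fin n) (Fin n) ℂ).charpoly := by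
  rw [A.2.charpoly_eq, eigPoly, Polynomial.map_prod]
  refine Fintype.prod_equiv (Fin.revPerm.trans ((finCongr (Fintype.card_fin n).symm).trans
    (Fintype.equivOfCardEq (Fintype.card_fin _)))) _ _ fun i => ?_
  simp [eig, Matrix.IsHermitian.eigenvalues]

theorem roots_eigPoly {n : ℕ} (A : Herm n) : (eigPoly A).roots = Finset.univ.val.map (eig A) := by
  rw [← roots_multiset_prod_X_sub_C (Finset.univ.val.map (eig A)), Multiset.map_map]
  rfl

theorem splits_eigPoly {n : ℕ} (A : Herm n) : (eigPoly A).Splits :=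
  .prod fun _ _ => .X_sub_C _

theorem isAnalyticMonicFamily_eigPoly {n : ℕ} {H : ℝ → Herm n} (hH : AnalyticAtZero H) :
    IsAnalyticMonicFamily (fun t => eigPoly (H t)) n 0 where
  monic t := monic_prod_of_monic _ _ fun _ _ => monic_X_sub_C _
  natDegree_eq t := by
    rw [← splits_iff_card_roots.1 (splits_eigPoly _), roots_eigPoly, Multiset.card_map,
      Finset.card_val, Finset.card_univ, Fintype.card_fin]
  analyticAt_coeff i := by
    refine ((Complex.reCLM.analyticAt _).comp (analyticAt_coeff_charpoly hH.apply i)).congr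
      (.of_forall fun t => ?_)
    simp only [Function.comp_apply, ← map_ofReal_eigPoly, coeff_map, Complex.ofRealHom_eq_coe,
      Complex.reCLM_apply, Complex.ofReal_re]

theorem exists_analyticAt_eventually_map_eig_eq {n : ℕ} {H : ℝ → Herm n} (hH : AnalyticAtZero H) :
    ∃ μ : Fin n → ℝ → ℝ, (∀ i, AnalyticAt ℝ (μ i) 0) ∧
      ∀ᶠ t in 𝓝 0, Finset.univ.val.map (eig (H t)) = Finset.univ.val.map fun i => μ i t := by
  obtain ⟨s, hs, hroots⟩ := (isAnalyticMonicFamily_eigPoly hH).hasAnalyticRoots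
    (.of_forall fun t => splits_eigPoly _)
  simp only [roots_eigPoly] at hroots
  obtain ⟨L, rfl⟩ := Quot.exists_rep s
  obtain rfl : n = L.length := by
    simpa using congrArg Multiset.card hroots.self_of_nhds
  refine ⟨L.get, fun i => hs _ (L.get_mem i), hroots.mono fun t ht => ht.trans ?_⟩
  rw [Fin.univ_val_map]
  exact congrArg _ (List.ext_getElem (by simp) fun i _ _ => by simp)

theorem eig_eq_of_monotone {n : ℕ} {A : Herm n} {v : Fin n → ℝ} {τ : Equiv.Perm (Fin n)}
    (h : Finset.univ.val.map (eig A) = Finset.univ.val.map v) (hv : Monotone fun i => v (τ i))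
    (i : Fin n) : eig A i = v (τ i) := by
  refine congrFun (eq_of_monotone_of_map_univ_eq (eig_monotone A) hv (h.trans ?_)) i
  rw [← Function.comp_def v, ← Multiset.map_map, Multiset.map_univ_val_equiv]

theorem exists_isAnalyticReordering {n : ℕ} {H : ℝ → Herm n} (hH : AnalyticAtZero H) :
    ∃ σ : Equiv.Perm (Fin n), IsAnalyticReordering H σ := by
  obtain ⟨μ, hμ, heig⟩ := exists_analyticAt_eventually_map_eig_eq hH
  obtain ⟨τ, hτ⟩ := exists_perm_eventually_monotone_nhdsGT hμ
  obtain ⟨ρ, hρ⟩ := exists_perm_eventually_monotone_nhdsLT hμ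
  have hτ₀ : Monotone fun i => μ (τ i) 0 := fun i j hij =>
    le_of_tendsto_of_tendsto ((hμ _).continuousAt.tendsto.mono_left nhdsWithin_le_nhds)
      ((hμ _).continuousAt.tendsto.mono_left nhdsWithin_le_nhds) (hτ.mono fun t ht => ht hij)
  refine ⟨τ.trans ρ.symm, fun i => (hμ (τ i)).congr ?_⟩
  filter_upwards [heig, eventually_nhdsWithin_iff.1 hτ, eventually_nhdsWithin_iff.1 hρ]
    with t heigt hτt hρt
  rw [reorderedEig]
  split_ifs with ht
  · rcases ht.eq_or_lt with rfl | ht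
    exacts [(eig_eq_of_monotone heigt hτ₀ i).symm, (eig_eq_of_monotone heigt (hτt ht) i).symm]
  · rw [eig_eq_of_monotone heigt (hρt (not_le.1 ht)), Equiv.trans_apply, Equiv.apply_symm_apply]

end Eigenvalues

section Spread

variable {x₀ : ℝ} {l : Filter ℝ} [l.NeBot]

theorem analyticOrderAt_sub_le_of_monotone {ι : Type*} [Preorder ι] {f : ι → ℝ → ℝ} {a b : ι}
    (hl : l ≤ 𝓝[≠] x₀) (hf : ∀ i, AnalyticAt ℝ (f i) x₀)
    (hmono : ∀ᶠ t in l, Monotone fun i => f i t) (ha : IsBot a) (hb : IsTop b) (i j : ι) :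
    analyticOrderAt (f a - f b) x₀ ≤ analyticOrderAt (f i - f j) x₀ := by
  refine analyticOrderAt_le_of_isBigO hl ((hf i).sub (hf j)) ((hf a).sub (hf b))
    (.of_bound' (hmono.mono fun t ht => ?_))
  have hdist := Real.dist_le_of_mem_Icc ⟨ht (ha i), ht (hb i)⟩ ⟨ht (ha j), ht (hb j)⟩
  calc ‖f i t - f j t‖ ≤ f b t - f a t := hdist
    _ ≤ |f b t - f a t| := le_abs_self _
    _ = ‖f a t - f b t‖ := abs_sub_comm _ _

theorem iInf_analyticOrderAt_sub_of_lt {ι : Type*} [PartialOrder ι] {f : ι → ℝ → ℝ} {a b : ι}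
    (hl : l ≤ 𝓝[≠] x₀) (hf : ∀ i, AnalyticAt ℝ (f i) x₀)
    (hmono : ∀ᶠ t in l, Monotone fun i => f i t) (ha : IsBot a) (hb : IsTop b) :
    ⨅ (i) (j) (_ : i < j), analyticOrderAt (f i - f j) x₀ = analyticOrderAt (f a - f b) x₀ := by
  refine le_antisymm ?_ (le_iInf fun i => le_iInf fun j => le_iInf fun _ =>
    analyticOrderAt_sub_le_of_monotone hl hf hmono ha hb i j)
  rcases (ha b).eq_or_lt with rfl | hab
  · exact le_top.trans_eq (analyticOrderAt_eq_top.2 (.of_forall fun t => sub_self (f a t))).symm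
  · exact iInf₂_le_of_le a b (iInf_le _ hab)

theorem iInf_analyticOrderAt_sub_of_succ_eq {k : ℕ} {f : Fin k → ℝ → ℝ} {a b : Fin k}
    (hl : l ≤ 𝓝[≠] x₀) (hf : ∀ i, AnalyticAt ℝ (f i) x₀)
    (hmono : ∀ᶠ t in l, Monotone fun i => f i t) (ha : IsBot a) (hb : IsTop b) :
    ⨅ (i : Fin k) (j : Fin k) (_ : (i : ℕ) + 1 = j), analyticOrderAt (f i - f j) x₀ =
      analyticOrderAt (f a - f b) x₀ := by
  refine le_antisymm ?_ (le_iInf fun i => le_iInf fun j => le_iInf fun _ =>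
    analyticOrderAt_sub_le_of_monotone hl hf hmono ha hb i j)
  set N := ⨅ (i : Fin k) (j : Fin k) (_ : (i : ℕ) + 1 = j), analyticOrderAt (f i - f j) x₀
  have hN : ∀ m (hm : m < k), N ≤ analyticOrderAt (f a - f ⟨m, hm⟩) x₀ := fun m => by
    induction m with
    | zero =>
      intro hm
      obtain rfl : a = ⟨0, hm⟩ := (ha _).antisymm (Fin.mk_le_of_le_val (Nat.zero_le _))
      exact le_top.trans_eq (analyticOrderAt_eq_top.2 (.of_forall fun t => sub_self (f _ t))).symm
    | succ m ih =>
      intro hm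
      have hconsecutive : N ≤ analyticOrderAt (f ⟨m, by omega⟩ - f ⟨m + 1, hm⟩) x₀ :=
        iInf₂_le_of_le ⟨m, _⟩ ⟨m + 1, hm⟩ (iInf_le _ rfl)
      rw [← sub_add_sub_cancel (f a) (f ⟨m, by omega⟩)]
      exact (le_min (ih _) hconsecutive).trans le_analyticOrderAt_add
  exact hN b b.2

theorem iInf_analyticOrderAt_sub_mean {ι : Type*} [Preorder ι] [Fintype ι] {f : ι → ℝ → ℝ}
    {a b : ι} (hl : l ≤ 𝓝[≠] x₀) (hf : ∀ i, AnalyticAt ℝ (f i) x₀)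
    (hmono : ∀ᶠ t in l, Monotone fun i => f i t) (ha : IsBot a) (hb : IsTop b) :
    ⨅ i, analyticOrderAt (fun t => f i t - (∑ j, f j t) / Fintype.card ι) x₀ =
      analyticOrderAt (f a - f b) x₀ := by
  refine le_antisymm ?_ (le_iInf fun i => ?_)
  · have hab : f a - f b = (fun t => f a t - (∑ j, f j t) / Fintype.card ι) -
        fun t => f b t - (∑ j, f j t) / Fintype.card ι := by
      ext t
      simp only [Pi.sub_apply, sub_sub_sub_cancel_right]
    rw [hab]
    exact (le_min (iInf_le _ a) (iInf_le _ b)).trans le_analyticOrderAt_sub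
  · have : Nonempty ι := ⟨a⟩
    have hcard : (Fintype.card ι : ℝ) ≠ 0 := Nat.cast_ne_zero.2 Fintype.card_ne_zero
    have hsub : (fun t => f i t - (∑ j, f j t) / Fintype.card ι) =
        (fun _ : ℝ => (Fintype.card ι : ℝ)⁻¹) • ∑ j, (f i - f j) := by
      ext t
      simp only [Pi.smul_apply', Finset.sum_apply, Pi.sub_apply, smul_eq_mul]
      rw [Finset.sum_sub_distrib, Finset.sum_const, Finset.card_univ, nsmul_eq_mul]
      field_simp
    rw [hsub, analyticOrderAt_smul analyticAt_const
      (Finset.analyticAt_sum _ fun j _ => (hf i).sub (hf j))]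
    exact le_add_left (le_analyticOrderAt_sum _ fun j _ =>
      analyticOrderAt_sub_le_of_monotone hl hf hmono ha hb i j)

end Spread

section Reordering

/-- The inequality `λ_k < λ_{k+1}`, void for `k = n`, that separates the lowest `k` eigenvalues
from the others; unlike `GroundDegenerate`, it does not require the lowest `k` to coincide. -/
def HasGapAt {n : ℕ} (A : Herm n) (k : ℕ) : Prop :=
  ∀ i j : Fin n, (i : ℕ) + 1 = k → (j : ℕ) = k → eig A i < eig A j

variable {n k : ℕ} {H : ℝ → Herm n} {σ : Equiv.Perm (Fin n)}

theorem reorderedEig_of_nonneg (H : ℝ → Herm n) (σ : Equiv.Perm (Fin n)) (i : Fin n) {t : ℝ}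
    (ht : 0 ≤ t) : reorderedEig H σ i t = eig (H t) i :=
  if_pos ht

theorem reorderedEig_of_neg (H : ℝ → Herm n) (σ : Equiv.Perm (Fin n)) (i : Fin n) {t : ℝ}
    (ht : t < 0) : reorderedEig H σ i t = eig (H t) (σ i) :=
  if_neg ht.not_ge

theorem eventually_monotone_reorderedEig_castLE (H : ℝ → Herm n) (σ : Equiv.Perm (Fin n))
    (hkn : k ≤ n) :
    ∀ᶠ t in 𝓝[>] (0 : ℝ), Monotone fun i : Fin k => reorderedEig H σ (Fin.castLE hkn i) t := by
  filter_upwards [eventually_mem_nhdsWithin] with t (ht : 0 < t) i j hij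
  simpa only [reorderedEig_of_nonneg H σ _ ht.le] using eig_monotone (H t) hij

namespace IsAnalyticReordering

theorem eventuallyEq {ρ : Equiv.Perm (Fin n)} (hσ : IsAnalyticReordering H σ)
    (hρ : IsAnalyticReordering H ρ) (i : Fin n) :
    reorderedEig H σ i =ᶠ[𝓝 0] reorderedEig H ρ i := by
  have heq : ∀ᶠ t in 𝓝[>] (0 : ℝ), reorderedEig H σ i t = reorderedEig H ρ i t := by
    filter_upwards [eventually_mem_nhdsWithin] with t (ht : 0 < t)
    simp only [reorderedEig_of_nonneg H _ _ ht.le]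
  exact ((hσ i).frequently_eq_iff_eventually_eq (hρ i)).1
    (heq.frequently.filter_mono (nhdsGT_le_nhdsNE 0))

theorem analyticOrderAt_pairSplitting_eq {ρ : Equiv.Perm (Fin n)}
    (hσ : IsAnalyticReordering H σ) (hρ : IsAnalyticReordering H ρ) (hkn : k ≤ n) (i j : Fin k) :
    analyticOrderAt (pairSplitting hkn H σ i j) 0 =
      analyticOrderAt (pairSplitting hkn H ρ i j) 0 :=
  analyticOrderAt_congr ((hσ.eventuallyEq hρ _).sub (hσ.eventuallyEq hρ _))

theorem eig_apply_zero (hσ : IsAnalyticReordering H σ) (i : Fin n) :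
    eig (H 0) (σ i) = eig (H 0) i := by
  have hlim (j : Fin n) : Tendsto (fun t => eig (H t) j) (𝓝[<] 0) (𝓝 (eig (H 0) (σ.symm j))) := by
    have hcont := (hσ (σ.symm j)).continuousAt.tendsto.mono_left
      (nhdsWithin_le_nhds (s := Set.Iio 0))
    rw [reorderedEig_of_nonneg H σ _ le_rfl] at hcont
    refine hcont.congr' ?_
    filter_upwards [eventually_mem_nhdsWithin] with t (ht : t < 0)
    rw [reorderedEig_of_neg H σ _ ht, Equiv.apply_symm_apply]
  have hmono : Monotone (eig (H 0) ∘ σ.symm) := fun i j hij =>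
    le_of_tendsto_of_tendsto' (hlim i) (hlim j) fun t => eig_monotone (H t) hij
  have hcomp : eig (H 0) ∘ σ.symm = eig (H 0) ∘ Equiv.refl _ :=
    Tuple.unique_monotone hmono (eig_monotone (H 0))
  simpa using (congrFun hcomp (σ i)).symm

theorem apply_lt (hσ : IsAnalyticReordering H σ)
    (hgap : HasGapAt (H 0) k) {i : Fin n} (hi : (i : ℕ) < k) : (σ i : ℕ) < k := by
  by_contra! hσi
  refine (hσ.eig_apply_zero i).not_gt ?_
  calc eig (H 0) i ≤ eig (H 0) ⟨k - 1, by omega⟩ :=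
        eig_monotone _ (Fin.le_def.2 (Nat.le_sub_one_of_lt hi))
    _ < eig (H 0) ⟨k, by omega⟩ := hgap _ _ (Nat.sub_add_cancel (by omega)) rfl
    _ ≤ eig (H 0) (σ i) := eig_monotone _ hσi

theorem sum_comp_reorderedEig_castLE {M : Type*} [AddCommMonoid M]
    (hσ : IsAnalyticReordering H σ) (hkn : k ≤ n)
    (hgap : HasGapAt (H 0) k) (F : ℝ → M) (t : ℝ) :
    ∑ i : Fin k, F (reorderedEig H σ (Fin.castLE hkn i) t) =
      ∑ i : Fin k, F (eig (H t) (Fin.castLE hkn i)) := by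
  rcases le_or_gt 0 t with ht | ht
  · simp only [reorderedEig_of_nonneg H σ _ ht]
  let τ : Fin k → Fin k := fun i => (σ (Fin.castLE hkn i)).castLT (hσ.apply_lt hgap i.2)
  have hτ : τ.Injective := fun i j hij =>
    Fin.castLE_injective hkn (σ.injective (Fin.ext (congrArg Fin.val hij :)))
  simp only [reorderedEig_of_neg H σ _ ht]
  exact (Finite.injective_iff_bijective.1 hτ).sum_comp fun i => F (eig (H t) (Fin.castLE hkn i))

theorem lowMean_eq (hσ : IsAnalyticReordering H σ) (hkn : k ≤ n) (hgap : HasGapAt (H 0) k)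
    (t : ℝ) :
    lowMean hkn (H t) = (∑ i : Fin k, reorderedEig H σ (Fin.castLE hkn i) t) / k := by
  rw [lowMean, ← hσ.sum_comp_reorderedEig_castLE hkn hgap fun x => x]

theorem lowStdDev_eq (hσ : IsAnalyticReordering H σ) (hkn : k ≤ n)
    (hgap : HasGapAt (H 0) k) (t : ℝ) :
    lowStdDev hkn (H t) = √((∑ i : Fin k, meanSplitting hkn H σ i t ^ 2) / k) := by
  rw [lowStdDev,
    ← hσ.sum_comp_reorderedEig_castLE hkn hgap fun x => (x - lowMean hkn (H t)) ^ 2]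
  rfl

theorem meanSplitting_eq (hσ : IsAnalyticReordering H σ) (hkn : k ≤ n)
    (hgap : HasGapAt (H 0) k) (i : Fin k) :
    meanSplitting hkn H σ i = fun t => reorderedEig H σ (Fin.castLE hkn i) t -
      (∑ j : Fin k, reorderedEig H σ (Fin.castLE hkn j) t) / k := by
  ext t
  rw [meanSplitting, hσ.lowMean_eq hkn hgap]

theorem analyticAt_meanSplitting (hσ : IsAnalyticReordering H σ) (hkn : k ≤ n)
    (hgap : HasGapAt (H 0) k) (i : Fin k) :
    AnalyticAt ℝ (meanSplitting hkn H σ i) 0 := by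
  rw [hσ.meanSplitting_eq hkn hgap]
  exact (hσ _).sub (Finset.analyticAt_fun_sum _ fun j _ => hσ _).div_const

theorem iInf_analyticOrderAt_meanSplitting (hσ : IsAnalyticReordering H σ) (hkn : k ≤ n)
    (hgap : HasGapAt (H 0) k) {a b : Fin k} (ha : IsBot a) (hb : IsTop b) :
    ⨅ i, analyticOrderAt (meanSplitting hkn H σ i) 0 =
      analyticOrderAt (pairSplitting hkn H σ a b) 0 := by
  simp only [hσ.meanSplitting_eq hkn hgap]
  simpa only [Fintype.card_fin] using!
    iInf_analyticOrderAt_sub_mean (nhdsGT_le_nhdsNE 0) (fun i => hσ (Fin.castLE hkn i))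
      (eventually_monotone_reorderedEig_castLE H σ hkn) ha hb

theorem analyticAt_signedStdDev (hσ : IsAnalyticReordering H σ) (hkn : k ≤ n) (hk : k ≠ 0)
    (hgap : HasGapAt (H 0) k)
    {r : ℕ∞} (hr : ⨅ i, analyticOrderAt (meanSplitting hkn H σ i) 0 = r) :
    AnalyticAt ℝ (signedStdDev hkn H r.toNat) 0 ∧
      analyticOrderAt (signedStdDev hkn H r.toNat) 0 = r := by
  have hmean := hσ.analyticAt_meanSplitting hkn hgap
  have hsum : AnalyticAt ℝ (fun t => ∑ i, meanSplitting hkn H σ i t ^ 2) 0 :=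
    Finset.analyticAt_fun_sum _ fun i _ => (hmean i).pow 2
  have hord : analyticOrderAt (fun t => (∑ i, meanSplitting hkn H σ i t ^ 2) / k) 0 = 2 * r := by
    have hconst : analyticOrderAt (fun _ : ℝ => (k : ℝ)⁻¹) 0 = 0 :=
      analyticAt_const.analyticOrderAt_eq_zero.2 (inv_ne_zero (Nat.cast_ne_zero.2 hk))
    have hmul := analyticOrderAt_mul hsum (analyticAt_const (v := (k : ℝ)⁻¹))
    rwa [hconst, add_zero, analyticOrderAt_sum_sq hmean, hr] at hmul
  have hsigned : signedStdDev hkn H r.toNat = fun t => Real.sign (t - 0) ^ r.toNat *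
      √((∑ i, meanSplitting hkn H σ i t ^ 2) / k) := by
    ext t
    rw [signedStdDev, hσ.lowStdDev_eq hkn hgap, sub_zero]
  rw [hsigned]
  exact analyticAt_sign_pow_mul_sqrt hsum.div_const
    (.of_forall fun t => by positivity) hord

end IsAnalyticReordering

end Reordering

end EnergySplitting

theorem mainTheorem5_general (n k : ℕ) (hk : 1 ≤ k) (hkn : k ≤ n)
    (H : ℝ → EnergySplitting.Herm n) (hH : EnergySplitting.AnalyticAtZero H)
    (hgap : EnergySplitting.HasGapAt (H 0) k) :
    (∃ σ : Equiv.Perm (Fin n), EnergySplitting.IsAnalyticReordering H σ) ∧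
    ∃ r : ℕ∞,
      AnalyticAt ℝ (EnergySplitting.signedStdDev hkn H r.toNat) 0 ∧
      analyticOrderAt (EnergySplitting.signedStdDev hkn H r.toNat) 0 = r ∧
      ∀ σ : Equiv.Perm (Fin n), EnergySplitting.IsAnalyticReordering H σ →
        (∀ i : Fin k, AnalyticAt ℝ (EnergySplitting.meanSplitting hkn H σ i) 0) ∧
        (⨅ (i : Fin k) (j : Fin k) (_ : i < j),
          analyticOrderAt (EnergySplitting.pairSplitting hkn H σ i j) 0) = r ∧
        (⨅ (i : Fin k) (j : Fin k) (_ : (i : ℕ) + 1 = j),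
          analyticOrderAt (EnergySplitting.pairSplitting hkn H σ i j) 0) = r ∧
        analyticOrderAt (EnergySplitting.pairSplitting hkn H σ
          ⟨0, Nat.lt_of_lt_of_le Nat.zero_lt_one hk⟩
          ⟨k - 1, Nat.sub_lt (Nat.lt_of_lt_of_le Nat.zero_lt_one hk) Nat.zero_lt_one⟩) 0 = r ∧
        (⨅ i : Fin k,
          analyticOrderAt (EnergySplitting.meanSplitting hkn H σ i) 0) = r := by
  obtain ⟨ρ, hρ⟩ := EnergySplitting.exists_isAnalyticReordering hH
  have hbot : IsBot (⟨0, Nat.lt_of_lt_of_le Nat.zero_lt_one hk⟩ : Fin k) :=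
    fun i => Fin.mk_le_of_le_val (Nat.zero_le _)
  have htop : IsTop (⟨k - 1, Nat.sub_lt (Nat.lt_of_lt_of_le Nat.zero_lt_one hk)
      Nat.zero_lt_one⟩ : Fin k) := fun i => Fin.le_def.2 (Nat.le_sub_one_of_lt i.2)
  obtain ⟨hsigned, hord⟩ := hρ.analyticAt_signedStdDev hkn (Nat.one_le_iff_ne_zero.1 hk) hgap
    (hρ.iInf_analyticOrderAt_meanSplitting hkn hgap hbot htop)
  refine ⟨⟨ρ, hρ⟩, _, hsigned, hord, fun σ hσ => ?_⟩
  have hpos := nhdsGT_le_nhdsNE (0 : ℝ)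
  have hmono := EnergySplitting.eventually_monotone_reorderedEig_castLE H σ hkn
  rw [← hσ.analyticOrderAt_pairSplitting_eq hρ]
  exact ⟨hσ.analyticAt_meanSplitting hkn hgap,
    EnergySplitting.iInf_analyticOrderAt_sub_of_lt hpos (fun _ => hσ _) hmono hbot htop,
    EnergySplitting.iInf_analyticOrderAt_sub_of_succ_eq hpos (fun _ => hσ _) hmono hbot htop,
    rfl, hσ.iInf_analyticOrderAt_meanSplitting hkn hgap hbot htop⟩

theorem mainTheorem5 (n k : ℕ) (hk : 1 ≤ k) (hkn : k ≤ n)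
    (H : ℝ → EnergySplitting.Herm n) (hH : EnergySplitting.AnalyticAtZero H)
    (h0 : H 0 ∈ EnergySplitting.GroundDegenerate n k) :
    (∃ σ : Equiv.Perm (Fin n), EnergySplitting.IsAnalyticReordering H σ) ∧
    ∃ r : ℕ∞,
      AnalyticAt ℝ (EnergySplitting.signedStdDev hkn H r.toNat) 0 ∧
      analyticOrderAt (EnergySplitting.signedStdDev hkn H r.toNat) 0 = r ∧
      ∀ σ : Equiv.Perm (Fin n), EnergySplitting.IsAnalyticReordering H σ →
        (∀ i : Fin k, AnalyticAt ℝ (EnergySplitting.meanSplitting hkn H σ i) 0) ∧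
        (⨅ (i : Fin k) (j : Fin k) (_ : i < j),
          analyticOrderAt (EnergySplitting.pairSplitting hkn H σ i j) 0) = r ∧
        (⨅ (i : Fin k) (j : Fin k) (_ : (i : ℕ) + 1 = j),
          analyticOrderAt (EnergySplitting.pairSplitting hkn H σ i j) 0) = r ∧
        analyticOrderAt (EnergySplitting.pairSplitting hkn H σ
          ⟨0, Nat.lt_of_lt_of_le Nat.zero_lt_one hk⟩
          ⟨k - 1, Nat.sub_lt (Nat.lt_of_lt_of_le Nat.zero_lt_one hk) Nat.zero_lt_one⟩) 0 = r ∧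
        (⨅ i : Fin k,
          analyticOrderAt (EnergySplitting.meanSplitting hkn H σ i) 0) = r :=
  mainTheorem5_general n k hk hkn H hH h0.2
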